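/- For a partition $\lambda$ (a finite non-increasing sequence of positive integers, possibly empty), the hook length of a box of its Young diagram is the number of boxes consisting of the box itself, the boxes to its right in the same row, and the boxes below it in the same column. The partition $\lambda$ is a $t$-core if no box of its Young diagram has hook length $t$; it is an $(s,s+1,\dots,s+p)$-core if it is a $t$-core for every $t\in\{s,s+1,\dots,s+p\}$; and it is self-conjugate if its Young diagram equals its transpose. **Theorem.** Let $s\ge 1$ and $p\ge 2$ be integers. Then there are only finitely many self-conjugate $(s,s+1,\dots,s+p)$-core partitions, and their number is \[ 1+\sum_{k=1}^{\lfloor s/2 \rfloor}\sum_{\ell=0}^{r_k}\binom{\lfloor \frac{k-1}{2} \rfloor}{\lfloor \frac{\ell}{2} \rfloor} \binom{\lfloor \frac{k}{2} \rfloor}{\lfloor \frac{\ell+1}{2} \rfloor}\binom{\lfloor \frac{s-\ell(p-2)}{2} \rfloor}{k}, \] where $r_k=\min\bigl(k-1,\lfloor (s-2k)/(p-2) \rfloor\bigr)$ if $p\ge 3$, and $r_k=k-1$ if $p=2$. -/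

import Mathlib

/-- The hook length of the box `c = (i, j)` of a Young diagram: the number of boxes of the hook of
`c`, i.e. the box `c` itself, the boxes to its right in row `i` and the boxes below it in
column `j`. -/
def YoungDiagram.hookLength (μ : YoungDiagram) (c : ℕ × ℕ) : ℕ :=
  (μ.cells.filter fun d => (d.1 = c.1 ∧ c.2 ≤ d.2) ∨ (d.2 = c.2 ∧ c.1 ≤ d.1)).card

/-- A partition is a `t`-core if no box of its Young diagram has hook length `t`. -/
def YoungDiagram.IsCore (μ : YoungDiagram) (t : ℕ) : Prop :=
  ∀ c ∈ μ, μ.hookLength c ≠ t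

/-- A partition is self-conjugate if it equals its conjugate (the transposed Young diagram). -/
def YoungDiagram.IsSelfConjugate (μ : YoungDiagram) : Prop :=
  μ.transpose = μ

/-- The set of self-conjugate `(s, s + 1, …, s + p)`-core partitions, of arbitrary size (the empty
partition included), each partition being given by its Young diagram. -/
def selfConjugateCores (s p : ℕ) : Set YoungDiagram :=
  {μ | μ.IsSelfConjugate ∧ ∀ i ≤ p, μ.IsCore (s + i)}

/-- The upper summation bound `r = min (k - 1, ⌊(s - 2k) / (p - 2)⌋)`, where for `p = 2` the second
entry is `∞`, so that `r = k - 1`. It is used only for `p ≥ 2` and `1 ≤ k ≤ s / 2`. -/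
def innerBound (s p k : ℕ) : ℕ :=
  if p = 2 then k - 1 else min (k - 1) ((s - 2 * k) / (p - 2))

/-! A partition is determined by its beta set `S`, and self-conjugacy says that `S` contains exactly
one of `x` and `-1 - x`. A hook then has length `β i + β j + 1`, so being a `t`-core means that `S`
is closed under subtracting `t` (`image_betaSet_selfConjugateCores`).

On an `s`-runner abacus, `S` amounts to a height function `g` on `ℤ` with `g (x + s) = g x - 1` and
`g (-1 - x) = 1 - g x`, and closure under `s + i` for `i ≤ p` becomes `g x ≤ g y + 1` whenever `y ≤
x ≤ y + p`. Both symmetries leave only half a period of data, together with boundary conditions at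
its two ends (`image_profileSet`).

Such a half-profile is cut into unit steps. Up steps have size one, and consecutive ones are at
least `p` apart; consecutive down steps may share a position; a change of direction takes distance
at least one. By `two_mul_stepGap`, a telescoping height term turns the unequal doubled gaps `2p`
and `0` into a common cost `p` per repeated direction, and `2` per change. The end conditions absorb
the telescoped term, so the profiles are exactly the balanced step lists of total cost at most `s`
(`image_pathFun_balancedPaths`).

With `k` steps, `l` of them repeating the previous direction, the cost is `2k + l(p-2)` plus twice
the total slack. The direction words contribute two binomials (`finite_wordSet_and_ncard`), the
slacks the third (`finite_boundedLists_and_ncard`), and summing over `(k, l)` gives the formula. -/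

namespace YoungDiagram

/-! ### Beta sets of self-conjugate partitions -/

theorem IsSelfConjugate.mem_iff {μ : YoungDiagram} (h : μ.IsSelfConjugate) (i j : ℕ) :
    (i, j) ∈ μ ↔ (j, i) ∈ μ := by
  have h' : μ.transpose = μ := h
  conv_lhs => rw [← h']
  simp

theorem IsSelfConjugate.colLen_eq {μ : YoungDiagram} (h : μ.IsSelfConjugate) (i : ℕ) :
    μ.colLen i = μ.rowLen i := by
  have h' : μ.transpose = μ := h
  rw [← rowLen_transpose, h']

theorem isSelfConjugate_of_mem_iff {μ : YoungDiagram} (h : ∀ i j, (i, j) ∈ μ ↔ (j, i) ∈ μ) :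
    μ.IsSelfConjugate := by
  show μ.transpose = μ
  ext ⟨i, j⟩
  rw [mem_cells, mem_cells, mem_transpose]
  exact h j i

theorem hookLength_add {μ : YoungDiagram} {i j : ℕ} (h : (i, j) ∈ μ) :
    μ.hookLength (i, j) + i + j + 1 = μ.rowLen i + μ.colLen j := by
  have hr := mem_iff_lt_rowLen.1 h
  have hc := mem_iff_lt_colLen.1 h
  have key : (μ.cells.filter fun d => (d.1 = i ∧ j ≤ d.2) ∨ (d.2 = j ∧ i ≤ d.1)) =
      (({i} : Finset ℕ) ×ˢ Finset.Ico j (μ.rowLen i)) ∪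
        (Finset.Ico (i + 1) (μ.colLen j) ×ˢ ({j} : Finset ℕ)) := by
    ext ⟨a, b⟩
    simp only [Finset.mem_filter, mem_cells, Finset.mem_union, Finset.mem_product,
      Finset.mem_singleton, Finset.mem_Ico]
    constructor
    · rintro ⟨hm, ⟨rfl, hb⟩ | ⟨rfl, ha⟩⟩
      · exact Or.inl ⟨rfl, hb, mem_iff_lt_rowLen.1 hm⟩
      · rcases Nat.eq_or_lt_of_le ha with rfl | ha
        · exact Or.inl ⟨rfl, le_rfl, hr⟩
        · exact Or.inr ⟨⟨ha, mem_iff_lt_colLen.1 hm⟩, rfl⟩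
    · rintro (⟨rfl, hb, hb'⟩ | ⟨⟨ha, ha'⟩, rfl⟩)
      · exact ⟨mem_iff_lt_rowLen.2 hb', Or.inl ⟨rfl, hb⟩⟩
      · exact ⟨mem_iff_lt_colLen.2 ha', Or.inr ⟨rfl, by omega⟩⟩
  have hd : Disjoint (({i} : Finset ℕ) ×ˢ Finset.Ico j (μ.rowLen i))
      (Finset.Ico (i + 1) (μ.colLen j) ×ˢ ({j} : Finset ℕ)) := by
    rw [Finset.disjoint_left]
    rintro ⟨a, b⟩ h1 h2
    simp only [Finset.mem_product, Finset.mem_singleton, Finset.mem_Ico] at h1 h2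
    omega
  have : μ.hookLength (i, j) = (μ.rowLen i - j) + (μ.colLen j - (i + 1)) := by
    show (μ.cells.filter fun d => (d.1 = i ∧ j ≤ d.2) ∨ (d.2 = j ∧ i ≤ d.1)).card = _
    rw [key, Finset.card_union_of_disjoint hd]
    simp
  omega

/-- The beta number of row `i`: the position of the vertical boundary step of that row. -/
def beta (μ : YoungDiagram) (i : ℕ) : ℤ := (μ.rowLen i : ℤ) - i - 1

/-- The set of all beta numbers, i.e. the Maya diagram of a partition. -/
def betaSet (μ : YoungDiagram) : Set ℤ := Set.range μ.beta

theorem beta_strictAnti (μ : YoungDiagram) : StrictAnti μ.beta := by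
  intro i j hij
  have := μ.rowLen_anti i j hij.le
  simp only [beta]
  omega

theorem strictAnti_eq_of_range_eq {f g : ℕ → ℤ} (hf : StrictAnti f) (hg : StrictAnti g)
    (h : Set.range f = Set.range g) : f = g := by
  have hf' : StrictMono fun n => OrderDual.toDual (f n) := fun a b hab => hf hab
  have hg' : StrictMono fun n => OrderDual.toDual (g n) := fun a b hab => hg hab
  have := (StrictMono.range_inj hf' hg').1 h
  exact this

theorem betaSet_injective : Function.Injective betaSet := by
  intro μ ν h
  have h1 := strictAnti_eq_of_range_eq μ.beta_strictAnti ν.beta_strictAnti h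
  ext ⟨i, j⟩
  rw [mem_cells, mem_cells, mem_iff_lt_rowLen, mem_iff_lt_rowLen]
  have := congrFun h1 i
  simp only [beta] at this
  omega

theorem IsSelfConjugate.mem_iff_beta {μ : YoungDiagram} (h : μ.IsSelfConjugate) (i j : ℕ) :
    (i, j) ∈ μ ↔ 0 ≤ μ.beta i + μ.beta j := by
  have h1 : (i, j) ∈ μ ↔ j < μ.rowLen i := mem_iff_lt_rowLen
  have h2 : (i, j) ∈ μ ↔ i < μ.rowLen j := (h.mem_iff i j).trans mem_iff_lt_rowLen
  simp only [beta]
  constructor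
  · intro hm
    have := h1.1 hm
    have := h2.1 hm
    omega
  · intro hm
    by_contra hn
    have := mt h1.2 hn
    have := mt h2.2 hn
    omega

theorem IsSelfConjugate.beta_add_ne {μ : YoungDiagram} (h : μ.IsSelfConjugate) (i j : ℕ) :
    μ.beta i + μ.beta j ≠ -1 := by
  have h1 : (i, j) ∈ μ ↔ j < μ.rowLen i := mem_iff_lt_rowLen
  have h2 : (i, j) ∈ μ ↔ i < μ.rowLen j := (h.mem_iff i j).trans mem_iff_lt_rowLen
  simp only [beta]
  by_cases hm : (i, j) ∈ μ
  · have := h1.1 hm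
    have := h2.1 hm
    omega
  · have := mt h1.2 hm
    have := mt h2.2 hm
    omega

/-- Since columns have the same lengths as rows, a hook length is `β i + β j + 1`. Pairs outside the
diagram have `β i + β j < 0` and cannot produce a positive `t`, so membership drops out of the
condition. -/
theorem IsSelfConjugate.isCore_iff {μ : YoungDiagram} (h : μ.IsSelfConjugate) {t : ℕ}
    (ht : 1 ≤ t) : μ.IsCore t ↔ ∀ i j, μ.beta i + μ.beta j + 1 ≠ t := by
  have hook : ∀ i j, (i, j) ∈ μ → (μ.hookLength (i, j) : ℤ) = μ.beta i + μ.beta j + 1 := by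
    intro i j hm
    have h1 := hookLength_add hm
    rw [h.colLen_eq] at h1
    simp only [beta]
    omega
  constructor
  · intro hc i j heq
    have hm : (i, j) ∈ μ := (h.mem_iff_beta i j).2 (by omega)
    have h1 := hook i j hm
    exact hc (i, j) hm (by omega)
  · rintro hc ⟨i, j⟩ hm heq
    have h1 := hook i j hm
    exact hc i j (by omega)

theorem IsSelfConjugate.mem_betaSet_iff {μ : YoungDiagram} (h : μ.IsSelfConjugate) (x : ℤ) :
    x ∈ μ.betaSet ↔ -1 - x ∉ μ.betaSet := by
  constructor
  · rintro ⟨i, rfl⟩ ⟨j, hj⟩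
    exact h.beta_add_ne i j (by omega)
  · intro hx
    have hex : ∃ i, μ.beta i ≤ x := by
      refine ⟨(μ.rowLen 0 + x.natAbs), ?_⟩
      have := μ.rowLen_anti 0 (μ.rowLen 0 + x.natAbs) (Nat.zero_le _)
      simp only [beta]
      omega
    classical
    obtain ⟨i, hi, hmin⟩ : ∃ i, μ.beta i ≤ x ∧ ∀ k < i, x < μ.beta k :=
      ⟨Nat.find hex, Nat.find_spec hex, fun k hk => not_le.1 (Nat.find_min hex hk)⟩
    by_contra hne
    have hlt : μ.beta i < x := lt_of_le_of_ne hi fun e => hne ⟨i, e⟩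
    apply hx
    simp only [beta] at hlt
    -- The gap at `x` is the horizontal boundary step of column `x + i`. That column has length `i`,
    -- and by symmetry so does row `x + i`, whose beta number is `-1 - x`.
    obtain ⟨j, hj⟩ : ∃ j : ℕ, (j : ℤ) = x + i := ⟨(x + i).toNat, by omega⟩
    refine ⟨j, ?_⟩
    have h1 : ¬ i < μ.rowLen j := by
      rw [← mem_iff_lt_rowLen, ← h.mem_iff, mem_iff_lt_rowLen]
      omega
    have h2 : ∀ k < i, k < μ.rowLen j := by
      intro k hk
      rw [← mem_iff_lt_rowLen, ← h.mem_iff, mem_iff_lt_rowLen]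
      have hk' := hmin (i - 1) (by omega)
      have := μ.rowLen_anti k (i - 1) (by omega)
      simp only [beta] at hk'
      omega
    have h3 : μ.rowLen j = i := by
      rcases Nat.eq_zero_or_pos i with h0 | h0
      · omega
      · have := h2 (i - 1) (by omega)
        omega
    simp only [beta, h3]
    omega

theorem bddAbove_betaSet (μ : YoungDiagram) : BddAbove μ.betaSet := by
  refine ⟨μ.beta 0, ?_⟩
  rintro _ ⟨i, rfl⟩
  exact μ.beta_strictAnti.antitone (Nat.zero_le i)

end YoungDiagram

/-! ### Symmetric core sets and their realization by Young diagrams -/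

/-- The beta sets of self-conjugate `(s, …, s + p)`-cores. -/
structure IsSymmetricCoreSet (s p : ℕ) (S : Set ℤ) : Prop where
  bddAbove : BddAbove S
  symm : ∀ x, x ∈ S ↔ -1 - x ∉ S
  sub_mem : ∀ i ≤ p, ∀ x ∈ S, x - (s + i) ∈ S

theorem ncard_inter_Ici_eq {S : Set ℤ} {f : ℕ → ℤ} (hf : StrictAnti f) (hS : Set.range f = S)
    {a : ℤ} {n : ℕ} (h : ∀ j, j < n ↔ a ≤ f j) : (S ∩ Set.Ici a).ncard = n := by
  have : S ∩ Set.Ici a = f '' (Finset.range n : Set ℕ) := by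
    ext x
    simp only [Set.mem_inter_iff, Set.mem_Ici, Set.mem_image, Finset.coe_range, Set.mem_Iio, ← hS,
      Set.mem_range]
    constructor
    · rintro ⟨⟨j, rfl⟩, hj⟩
      exact ⟨j, (h j).2 hj, rfl⟩
    · rintro ⟨j, hj, rfl⟩
      exact ⟨⟨j, rfl⟩, (h j).1 hj⟩
  rw [this, Set.ncard_image_of_injective _ hf.injective, Set.ncard_coe_finset, Finset.card_range]

theorem finite_inter_Ici {S : Set ℤ} (h : BddAbove S) (a : ℤ) : (S ∩ Set.Ici a).Finite := by
  obtain ⟨M, hM⟩ := h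
  exact (Set.finite_Icc a M).subset fun x hx => ⟨hx.2, hM hx.1⟩

theorem ncard_inter_Ici_of_mem {S : Set ℤ} (h : BddAbove S) {a : ℤ} (ha : a ∈ S) :
    (S ∩ Set.Ici a).ncard = (S ∩ Set.Ici (a + 1)).ncard + 1 := by
  have : S ∩ Set.Ici a = insert a (S ∩ Set.Ici (a + 1)) := by
    ext x
    simp only [Set.mem_inter_iff, Set.mem_Ici, Set.mem_insert_iff]
    constructor
    · rintro ⟨h1, h2⟩
      by_cases hx : x = a
      · exact Or.inl hx
      · exact Or.inr ⟨h1, by omega⟩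
    · rintro (rfl | ⟨h1, h2⟩)
      · exact ⟨ha, le_rfl⟩
      · exact ⟨h1, by omega⟩
  rw [this, Set.ncard_insert_of_notMem (by simp) (finite_inter_Ici h _)]

theorem ncard_inter_Ici_of_notMem {S : Set ℤ} {a : ℤ} (ha : a ∉ S) :
    (S ∩ Set.Ici a).ncard = (S ∩ Set.Ici (a + 1)).ncard := by
  congr 1
  ext x
  simp only [Set.mem_inter_iff, Set.mem_Ici]
  refine and_congr_right fun h1 => ?_
  have : x ≠ a := fun e => ha (e ▸ h1)
  omega

/-- Each of the `n` pairs `{m, -1 - m}` with `0 ≤ m < n` contributes exactly one element. -/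
theorem ncard_inter_Ici_neg_nat {S : Set ℤ} (h : BddAbove S) (hs : ∀ x, x ∈ S ↔ -1 - x ∉ S)
    (n : ℕ) : (S ∩ Set.Ici (-n : ℤ)).ncard = (S ∩ Set.Ici (n : ℤ)).ncard + n := by
  induction n with
  | zero => simp
  | succ n ih =>
    have e1 : (-((n + 1 : ℕ) : ℤ)) + 1 = -n := by push_cast; ring
    have e2 : -1 - (n : ℤ) = -((n + 1 : ℕ) : ℤ) := by push_cast; ring
    have e3 : ((n + 1 : ℕ) : ℤ) = n + 1 := by push_cast; ring
    have hn := hs n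
    rw [e2] at hn
    by_cases hm : (n : ℤ) ∈ S
    · have h1 := ncard_inter_Ici_of_mem h hm
      have h2 := ncard_inter_Ici_of_notMem (hn.1 hm)
      rw [e1] at h2
      rw [h2, ih, h1, e3]
      omega
    · have h1 := ncard_inter_Ici_of_notMem hm
      have h2 := ncard_inter_Ici_of_mem h (not_not.1 (mt hn.2 hm))
      rw [e1] at h2
      rw [h2, ih, h1, e3]
      omega

theorem ncard_inter_Ici_neg {S : Set ℤ} (h : BddAbove S) (hs : ∀ x, x ∈ S ↔ -1 - x ∉ S)
    (a : ℤ) : ((S ∩ Set.Ici (-a)).ncard : ℤ) = (S ∩ Set.Ici a).ncard + a := by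
  obtain ⟨n, rfl | rfl⟩ := a.eq_nat_or_neg
  · rw [ncard_inter_Ici_neg_nat h hs]
    push_cast
    ring
  · rw [neg_neg, ncard_inter_Ici_neg_nat h hs]
    push_cast
    ring

theorem exists_strictAnti_range_eq {S : Set ℤ} (h : BddAbove S) (hs : ∀ x, x ∈ S ↔ -1 - x ∉ S) :
    ∃ f : ℕ → ℤ, StrictAnti f ∧ Set.range f = S := by
  obtain ⟨M, hM⟩ := h
  have hlow : ∀ x, x < -1 - M → x ∈ S := by
    intro x hx
    rw [hs]
    intro h1
    have := hM h1
    omega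
  set P : ℕ → Prop := fun n => M - n ∈ S with hP
  have hinf : (Set.ofPred P).Infinite := by
    refine Set.infinite_of_not_bddAbove ?_
    rintro ⟨B, hB⟩
    have : (B + 1 + (2 * M + 2).toNat) ∈ Set.ofPred P := hlow _ (by push_cast; omega)
    have := hB this
    omega
  refine ⟨fun n => M - Nat.nth P n, fun a b hab => ?_, ?_⟩
  · have := Nat.nth_strictMono hinf hab
    show M - (Nat.nth P b : ℤ) < M - Nat.nth P a
    omega
  · ext x
    constructor
    · rintro ⟨n, rfl⟩
      exact Nat.nth_mem_of_infinite hinf n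
    · intro hx
      have hxM := hM hx
      have hm : (M - x).toNat ∈ Set.ofPred P := by
        show M - ((M - x).toNat : ℤ) ∈ S
        rwa [show M - ((M - x).toNat : ℤ) = x by omega]
      rw [← Nat.range_nth_of_infinite hinf] at hm
      obtain ⟨n, hn⟩ := hm
      refine ⟨n, ?_⟩
      show M - (Nat.nth P n : ℤ) = x
      rw [hn]
      omega

/-- If `f` lists `S` in decreasing order, the diagram must consist of the boxes with `0 ≤ f i + f
j`. Its beta numbers are again `f`, because the symmetry of `S` fixes the number of elements above
`-f i`. -/
theorem exists_selfConjugate_betaSet_eq {S : Set ℤ} (h : BddAbove S)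
    (hs : ∀ x, x ∈ S ↔ -1 - x ∉ S) :
    ∃ μ : YoungDiagram, μ.IsSelfConjugate ∧ μ.betaSet = S := by
  obtain ⟨f, hf, hS⟩ := exists_strictAnti_range_eq h hs
  have hdec : ∀ n : ℕ, f n ≤ f 0 - n := by
    intro n
    induction n with
    | zero => simp
    | succ n ih =>
      have := hf (Nat.lt_succ_self n)
      push_cast
      simp only [Nat.succ_eq_add_one] at this
      omega
  have hanti := hf.antitone
  set B := (2 * f 0 + 1).toNat with hB
  have hbound : ∀ i j, 0 ≤ f i + f j → j < B := by
    intro i j hij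
    have := hanti (Nat.zero_le i)
    have := hdec j
    omega
  let μ : YoungDiagram :=
    { cells := (Finset.range B ×ˢ Finset.range B).filter fun c => 0 ≤ f c.1 + f c.2
      isLowerSet := by
        rintro ⟨i, j⟩ ⟨i', j'⟩ ⟨hi, hj⟩ hm
        simp only [Finset.coe_filter, Finset.mem_product, Finset.mem_range, Set.mem_ofPred_eq]
          at hm ⊢
        have h1 : f i ≤ f i' := hanti hi
        have h2 : f j ≤ f j' := hanti hj
        have hi : i' ≤ i := hi
        have hj : j' ≤ j := hj
        omega }
  have hμ : ∀ i j, (i, j) ∈ μ ↔ 0 ≤ f i + f j := by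
    intro i j
    rw [← YoungDiagram.mem_cells]
    simp only [μ, Finset.mem_filter, Finset.mem_product, Finset.mem_range]
    refine ⟨fun hm => hm.2, fun hm => ⟨⟨hbound j i (by omega), hbound i j hm⟩, hm⟩⟩
  refine ⟨μ, YoungDiagram.isSelfConjugate_of_mem_iff fun i j => ?_, ?_⟩
  · rw [hμ, hμ, add_comm]
  · rw [← hS]
    unfold YoungDiagram.betaSet
    congr 1
    ext i
    -- Exactly `i + 1` elements are at least `f i`, and `rowLen i` are at least `-f i`; these counts
    -- differ by `f i`.
    have h1 := ncard_inter_Ici_eq hf hS (a := f i) (n := i + 1) fun j => by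
      rw [hf.le_iff_ge]
      omega
    have h2 := ncard_inter_Ici_eq hf hS (a := -f i) (n := μ.rowLen i) fun j => by
      rw [← YoungDiagram.mem_iff_lt_rowLen, hμ]
      omega
    have h3 := ncard_inter_Ici_neg h hs (f i)
    rw [h1, h2] at h3
    simp only [YoungDiagram.beta]
    push_cast at h3
    omega

theorem image_betaSet_selfConjugateCores {s p : ℕ} (hs : 1 ≤ s) :
    YoungDiagram.betaSet '' selfConjugateCores s p = {S | IsSymmetricCoreSet s p S} := by
  ext S
  constructor
  · rintro ⟨μ, ⟨hμ, hc⟩, rfl⟩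
    refine ⟨μ.bddAbove_betaSet, hμ.mem_betaSet_iff, ?_⟩
    rintro i hi _ ⟨a, rfl⟩
    rw [hμ.mem_betaSet_iff]
    rintro ⟨b, hb⟩
    refine (hμ.isCore_iff (by omega)).1 (hc i hi) a b ?_
    push_cast
    omega
  · intro hS
    obtain ⟨μ, hμ, rfl⟩ := exists_selfConjugate_betaSet_eq hS.bddAbove hS.symm
    refine ⟨μ, ⟨hμ, fun i hi => (hμ.isCore_iff (by omega)).2 fun a b hab => ?_⟩, rfl⟩
    have h1 := hS.sub_mem i hi _ ⟨a, rfl⟩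
    rw [hS.symm] at h1
    refine h1 ⟨b, ?_⟩
    push_cast at hab
    omega

/-! ### Height functions on half a period -/

/-- Half-period height functions encoding symmetric core sets: `f j` is, for `2 * j < s`, the height
of the abacus runner of `j`. -/
structure IsHalfProfile (s p : ℕ) (f : ℕ → ℤ) : Prop where
  eq_zero : ∀ j, s ≤ 2 * j + 1 → f j = 0
  le_add_one : ∀ i j, i ≤ j → j ≤ i + p → f j ≤ f i + 1
  le_one : ∀ j < p, f j ≤ 1
  of_neg : ∀ j, f j < 0 → 2 * j + p + 2 ≤ s

/-- The extension of a half-period height function to `ℤ` by its (quasi)symmetries. -/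
def extendProfile (s : ℕ) (f : ℕ → ℤ) (x : ℤ) : ℤ :=
  (if 2 * (x % s) < s then f (x % s).toNat else -f (s - 1 - x % s).toNat) - x / s

theorem extendProfile_left {s : ℕ} (f : ℕ → ℤ) {j : ℕ} (hj : 2 * j < s) (k : ℤ) :
    extendProfile s f (j + s * k) = f j - k := by
  have h1 : ((j : ℤ) + s * k) % s = j := by
    rw [Int.add_mul_emod_self_left, Int.emod_eq_of_lt (by omega) (by omega)]
  have h2 : ((j : ℤ) + s * k) / s = k := by
    rw [Int.add_mul_ediv_left _ _ (by omega), Int.ediv_eq_zero_of_lt (by omega) (by omega), zero_add]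
  rw [extendProfile, h1, h2, if_pos (by omega), Int.toNat_natCast]

theorem extendProfile_right {s p : ℕ} {f : ℕ → ℤ} (hf : IsHalfProfile s p f) {j : ℕ}
    (hj : 2 * j < s) (k : ℤ) : extendProfile s f (s - 1 - j + s * k) = -f j - k := by
  have h1 : ((s : ℤ) - 1 - j + s * k) % s = s - 1 - j := by
    rw [Int.add_mul_emod_self_left, Int.emod_eq_of_lt (by omega) (by omega)]
  have h2 : ((s : ℤ) - 1 - j + s * k) / s = k := by
    rw [Int.add_mul_ediv_left _ _ (by omega), Int.ediv_eq_zero_of_lt (by omega) (by omega), zero_add]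
  rw [extendProfile, h1, h2]
  split_ifs with h
  · rw [hf.eq_zero _ (by omega), hf.eq_zero j (by omega)]
    simp
  · rw [show ((s : ℤ) - 1 - (s - 1 - j)).toNat = j by omega]

theorem exists_half_period_rep {s : ℕ} (hs : 1 ≤ s) (x : ℤ) :
    ∃ (j : ℕ) (k : ℤ), 2 * j < s ∧ (x = j + s * k ∨ x = s - 1 - j + s * k) := by
  have h0 := Int.emod_nonneg x (b := s) (by omega)
  have h1 := Int.emod_lt_of_pos x (b := s) (by omega)
  have h2 := Int.emod_add_mul_ediv x s
  by_cases h : 2 * (x % s) < s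
  · refine ⟨(x % s).toNat, x / s, by omega, Or.inl ?_⟩
    rw [Int.toNat_of_nonneg h0, h2]
  · refine ⟨(s - 1 - x % s).toNat, x / s, by omega, Or.inr ?_⟩
    rw [Int.toNat_of_nonneg (by omega)]
    linarith

theorem extendProfile_add_mul {s : ℕ} (hs : 1 ≤ s) (f : ℕ → ℤ) (x k : ℤ) :
    extendProfile s f (x + s * k) = extendProfile s f x - k := by
  rw [extendProfile, extendProfile, Int.add_mul_emod_self_left,
    Int.add_mul_ediv_left _ _ (by omega)]
  ring

theorem extendProfile_neg {s p : ℕ} (hs : 1 ≤ s) {f : ℕ → ℤ} (hf : IsHalfProfile s p f) (x : ℤ) :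
    extendProfile s f (-1 - x) = 1 - extendProfile s f x := by
  obtain ⟨j, k, hj, rfl | rfl⟩ := exists_half_period_rep hs x
  · rw [show (-1 - (j + s * k) : ℤ) = s - 1 - j + s * (-k - 1) by ring, extendProfile_right hf hj,
      extendProfile_left f hj]
    ring
  · rw [show (-1 - (s - 1 - j + s * k) : ℤ) = j + s * (-k - 1) by ring, extendProfile_right hf hj,
      extendProfile_left f hj]
    ring

theorem period_quotient_cases {s k k' d : ℤ} (hs : 0 < s) (h1 : -s < s * (k - k') + d)
    (h2 : s * (k - k') + d < s) (hd : -s < d) (hd' : d < s) :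
    k = k' ∨ k = k' + 1 ∨ k' = k + 1 := by
  have : k - k' < 2 := by nlinarith
  have : -2 < k - k' := by nlinarith
  omega

/-- For points less than a period apart, the period indices differ by at most one. Each point lies
in the left or right half of its period, so finitely many linear cases remain. -/
theorem extendProfile_le_of_lt {s p : ℕ} (hs : 1 ≤ s) {f : ℕ → ℤ}
    (hf : IsHalfProfile s p f) {x y : ℤ} (hyx : y ≤ x) (hxy : x ≤ y + p) (hlt : x < y + s) :
    extendProfile s f x ≤ extendProfile s f y + 1 := by
  obtain ⟨j, k, hj, hx⟩ := exists_half_period_rep hs x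
  obtain ⟨j', k', hj', hy⟩ := exists_half_period_rep hs y
  have hmul : (s : ℤ) * k - s * k' = s * (k - k') := by ring
  have hk : k = k' ∨ k = k' + 1 ∨ k' = k + 1 := by
    rcases hx with rfl | rfl <;> rcases hy with rfl | rfl
    · exact period_quotient_cases (s := s) (d := (j : ℤ) - j') (by omega) (by linarith)
        (by linarith) (by omega) (by omega)
    · exact period_quotient_cases (s := s) (d := (j : ℤ) - (s - 1 - j')) (by omega) (by linarith)
        (by linarith) (by omega) (by omega)
    · exact period_quotient_cases (s := s) (d := (s - 1 - j : ℤ) - j') (by omega) (by linarith)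
        (by linarith) (by omega) (by omega)
    · exact period_quotient_cases (s := s) (d := (s - 1 - j : ℤ) - (s - 1 - j')) (by omega)
        (by linarith) (by linarith) (by omega) (by omega)
  have hZ := hf.eq_zero j
  have hZ' := hf.eq_zero j'
  have hN := hf.of_neg j
  have hN' := hf.of_neg j'
  have hO := hf.le_one j
  have hO' := hf.le_one j'
  have h0 := hf.le_one 0
  have hW := hf.le_add_one j j'
  have hW' := hf.le_add_one j' j
  have hz := hf.le_add_one 0 j
  have hz' := hf.le_add_one 0 j'
  have hm (m : ℤ) : (s : ℤ) * (m + 1) = s * m + s := by ring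
  rcases hk with rfl | rfl | rfl <;> rcases hx with rfl | rfl <;> rcases hy with rfl | rfl <;>
    simp only [extendProfile_left f hj, extendProfile_left f hj', extendProfile_right hf hj,
      extendProfile_right hf hj']
  all_goals try rw [hm] at hyx hxy hlt
  -- The product with `s` becomes an opaque integer, which leaves linear arithmetic.
  all_goals generalize (s : ℤ) * _ = K at *
  all_goals omega

theorem extendProfile_le_add_one {s p : ℕ} (hs : 1 ≤ s) {f : ℕ → ℤ} (hf : IsHalfProfile s p f)
    (i : ℕ) (hi : i ≤ p) (x : ℤ) : extendProfile s f x ≤ extendProfile s f (x - i) + 1 := by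
  induction i using Nat.strong_induction_on generalizing x with
  | _ i ih =>
    by_cases h : i < s
    · exact extendProfile_le_of_lt hs hf (by omega) (by omega) (by omega)
    · have h1 := ih (i - s) (by omega) (by omega) (x - s)
      rw [show x - s - ((i - s : ℕ) : ℤ) = x - i by omega,
        show x - (s : ℤ) = x + s * (-1) by ring, extendProfile_add_mul hs] at h1
      omega

/-- The subset of `ℤ` encoded by a half-period height function. -/
def profileSet (s : ℕ) (f : ℕ → ℤ) : Set ℤ := {x | 1 ≤ extendProfile s f x}

theorem IsHalfProfile.exists_le {s p : ℕ} {f : ℕ → ℤ} (hf : IsHalfProfile s p f) :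
    ∃ C : ℤ, ∀ j, |f j| ≤ C := by
  refine ⟨∑ j ∈ Finset.range s, |f j|, fun j => ?_⟩
  by_cases h : j < s
  · exact Finset.single_le_sum (f := fun j => |f j|) (fun i _ => abs_nonneg _)
      (Finset.mem_range.2 h)
  · rw [hf.eq_zero j (by omega), abs_zero]
    exact Finset.sum_nonneg fun i _ => abs_nonneg _

theorem isSymmetricCoreSet_profileSet {s p : ℕ} (hs : 1 ≤ s) {f : ℕ → ℤ}
    (hf : IsHalfProfile s p f) : IsSymmetricCoreSet s p (profileSet s f) where
  bddAbove := by
    obtain ⟨C, hC⟩ := hf.exists_le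
    refine ⟨s * (C + 1), fun x hx => ?_⟩
    have hx : 1 ≤ extendProfile s f x := hx
    have h2 := Int.emod_add_mul_ediv x s
    have h3 := Int.emod_lt_of_pos x (b := s) (by omega)
    have hle : x / s + 1 ≤ C := by
      have h4 := abs_le.1 (hC (x % s).toNat)
      have h5 := abs_le.1 (hC (s - 1 - x % s).toNat)
      unfold extendProfile at hx
      split_ifs at hx <;> omega
    have : (s : ℤ) * (x / s + 1) ≤ s * C := mul_le_mul_of_nonneg_left hle (by omega)
    nlinarith
  symm x := by
    show 1 ≤ extendProfile s f x ↔ ¬ 1 ≤ extendProfile s f (-1 - x)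
    rw [extendProfile_neg hs hf]
    omega
  sub_mem i hi x hx := by
    have hx : 1 ≤ extendProfile s f x := hx
    show 1 ≤ extendProfile s f (x - (s + i))
    have h1 := extendProfile_le_add_one hs hf i hi x
    rw [show x - (s + i : ℤ) = x - i + s * (-1) by ring, extendProfile_add_mul hs]
    omega

/-- The set recovers every level of the height: `m ≤ g x` exactly when `x + s * (m - 1)` belongs to
it. -/
theorem profileSet_injOn {s p : ℕ} (hs : 1 ≤ s) :
    Set.InjOn (profileSet s) {f | IsHalfProfile s p f} := by
  intro f hf g hg h
  have hle : ∀ x m : ℤ, m ≤ extendProfile s f x ↔ m ≤ extendProfile s g x := by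
    intro x m
    have h1 : x + s * (m - 1) ∈ profileSet s f ↔ x + s * (m - 1) ∈ profileSet s g := by rw [h]
    have h2 : 1 ≤ extendProfile s f (x + s * (m - 1)) ↔
      1 ≤ extendProfile s g (x + s * (m - 1)) := h1
    rw [extendProfile_add_mul hs, extendProfile_add_mul hs] at h2
    omega
  ext j
  by_cases hj : 2 * j < s
  · have h1 := extendProfile_left f hj 0
    have h2 := extendProfile_left g hj 0
    have h3 := (hle (j + s * 0) _).1 le_rfl
    have h4 := (hle (j + s * 0) _).2 le_rfl
    omega
  · rw [IsHalfProfile.eq_zero hf j (by omega), IsHalfProfile.eq_zero hg j (by omega)]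

theorem IsSymmetricCoreSet.exists_height {s p : ℕ} (hs : 1 ≤ s) {S : Set ℤ}
    (hS : IsSymmetricCoreSet s p S) : ∃ g : ℤ → ℤ, ∀ j m : ℤ, j + s * m ∈ S ↔ m < g j := by
  obtain ⟨M, hM⟩ := hS.bddAbove
  suffices h : ∀ j : ℤ, ∃ b : ℤ, ∀ m : ℤ, j + s * m ∈ S ↔ m < b by
    choose g hg using h
    exact ⟨g, hg⟩
  intro j
  have hdown : ∀ m, j + s * m ∈ S → j + s * (m - 1) ∈ S := by
    intro m hm
    have := hS.sub_mem 0 (Nat.zero_le _) _ hm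
    rwa [show j + s * m - (s + (0 : ℕ)) = j + s * (m - 1) by push_cast; ring] at this
  have hdown' : ∀ n : ℕ, ∀ m, j + s * m ∈ S → j + s * (m - n) ∈ S := by
    intro n
    induction n with
    | zero => intro m hm; simpa using hm
    | succ n ih =>
      intro m hm
      have := hdown _ (ih m hm)
      rwa [show m - ((n + 1 : ℕ) : ℤ) = m - n - 1 by push_cast; ring]
  obtain ⟨b, hb, hmax⟩ := Int.exists_greatest_of_bdd (P := fun m => j + s * m ∈ S)
    ⟨|M - j|, fun m hm => by
      have h1 := hM hm
      have h2 := le_abs_self (M - j)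
      rcases le_or_gt m 0 with h | h
      · exact h.trans (abs_nonneg _)
      · nlinarith⟩
    -- A point this low lies in `S`, since its reflection would exceed the upper bound `M`.
    ⟨-(|M + j| + 2), by
      rw [hS.symm]
      intro h
      have h1 := hM h
      have h2 := le_abs_self (M + j)
      nlinarith [abs_nonneg (M + j)]⟩
  refine ⟨b + 1, fun m => ⟨fun hm => Int.lt_add_one_iff.2 (hmax m hm), fun hm => ?_⟩⟩
  have := hdown' (b - m).toNat b hb
  rwa [show b - ((b - m).toNat : ℤ) = m by omega] at this

/-- The boundary conditions of a half-profile are the window inequality applied across the two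
centres of symmetry, `-1/2` for `le_one` and `(s - 1)/2` for `of_neg`. -/
theorem IsSymmetricCoreSet.exists_profile {s p : ℕ} (hs : 1 ≤ s) (hp : 1 ≤ p) {S : Set ℤ}
    (hS : IsSymmetricCoreSet s p S) : ∃ f, IsHalfProfile s p f ∧ profileSet s f = S := by
  obtain ⟨g, hg⟩ := hS.exists_height hs
  have heq : ∀ {a b : ℤ}, (∀ m : ℤ, m < a ↔ m < b) → a = b := by
    intro a b h
    have h1 := h (a - 1)
    have h2 := h (b - 1)
    omega
  have hshift : ∀ j k : ℤ, g (j + s * k) = g j - k := by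
    intro j k
    refine heq fun m => ?_
    rw [← hg, add_assoc, ← mul_add, hg]
    omega
  have hneg : ∀ j, g (-1 - j) = 1 - g j := by
    intro j
    refine heq fun m => ?_
    rw [← hg, hS.symm, show -1 - (-1 - j + s * m) = j + s * (-m) by ring, hg]
    omega
  have hrefl : ∀ j, g (s - 1 - j) = -g j := by
    intro j
    have h1 := hshift (-1 - j) 1
    rw [hneg, show -1 - j + s * 1 = s - 1 - j by ring] at h1
    omega
  have hwin : ∀ x y : ℤ, y ≤ x → x ≤ y + p → g x ≤ g y + 1 := by
    intro x y h1 h2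
    have h3 := hS.sub_mem (x - y).toNat (by omega) _ ((hg x (g x - 1)).2 (by omega))
    rw [show x + s * (g x - 1) - (s + ((x - y).toNat : ℤ)) = y + s * (g x - 2) by
      rw [Int.toNat_of_nonneg (by omega)]; ring, hg] at h3
    omega
  set f : ℕ → ℤ := fun j => if 2 * j < s then g j else 0 with hf
  have hfg : ∀ j : ℕ, 2 * j < s → f j = g j := fun j hj => if_pos hj
  have hf0 : ∀ j : ℕ, ¬ 2 * j < s → f j = 0 := fun j hj => if_neg hj
  have hofneg : ∀ j, f j < 0 → 2 * j + p + 2 ≤ s := by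
    intro j hj
    by_cases h : 2 * j < s
    · rw [hfg j h] at hj
      by_contra hlt
      have h1 := hwin (s - 1 - j) j (by omega) (by omega)
      rw [hrefl] at h1
      omega
    · rw [hf0 j h] at hj
      omega
  have hprof : IsHalfProfile s p f := by
    refine ⟨fun j hj => ?_, fun i j hij hjp => ?_, fun j hj => ?_, hofneg⟩
    · by_cases h : 2 * j < s
      · have h1 := hrefl j
        rw [show (s : ℤ) - 1 - j = j by omega] at h1
        rw [hfg j h]
        omega
      · exact hf0 j h
    · by_cases hj : 2 * j < s
      · rw [hfg j hj, hfg i (by omega)]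
        exact hwin _ _ (by omega) (by omega)
      · rw [hf0 j hj]
        -- Past the midpoint `f j` is set to `0`, so `f i ≤ -2` must be excluded. The window from
        -- `i` contains both `j` and its mirror image `s - 1 - j`, whose heights are opposite and
        -- hence not both at most `-1`.
        by_contra hlt
        have hi := hofneg i (by omega)
        have h1 := hwin j i (by omega) (by omega)
        have h2 := hwin (s - 1 - j) i (by omega) (by omega)
        rw [hrefl] at h2
        rw [hfg i (by omega)] at hlt
        omega
    · by_cases h : 2 * j < s
      · rw [hfg j h]
        have h0 := hneg 0
        have h1 := hwin 0 (-1) (by omega) (by omega)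
        have h2 := hwin j (-1) (by omega) (by omega)
        have h3 := hwin j 0 (by omega) (by omega)
        rw [sub_zero] at h0
        omega
      · rw [hf0 j h]
        omega
  have hext : ∀ x, extendProfile s f x = g x := by
    intro x
    obtain ⟨j, k, hj, rfl | rfl⟩ := exists_half_period_rep hs x
    · rw [extendProfile_left f hj, hshift, hfg j hj]
    · rw [extendProfile_right hprof hj, hshift, hrefl, hfg j hj]
  refine ⟨f, hprof, ?_⟩
  ext x
  show 1 ≤ extendProfile s f x ↔ x ∈ S
  have h1 := hg x 0
  rw [mul_zero, add_zero] at h1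
  rw [h1, hext]
  omega

theorem image_profileSet {s p : ℕ} (hs : 1 ≤ s) (hp : 1 ≤ p) :
    profileSet s '' {f | IsHalfProfile s p f} = {S | IsSymmetricCoreSet s p S} := by
  ext S
  constructor
  · rintro ⟨f, hf, rfl⟩
    exact isSymmetricCoreSet_profileSet hs hf
  · intro hS
    exact IsSymmetricCoreSet.exists_profile hs hp hS

/-! ### Height functions as lists of unit steps -/

/-- The least horizontal distance between consecutive unit steps, `true` being an up step. -/
def stepGap (p : ℕ) (x y : Bool) : ℕ := if x = y then (if x then p else 0) else 1

/-- The height change of a unit step. -/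
def stepSign (x : Bool) : ℤ := if x then 1 else -1

/-- The least symmetrized length used by a step `y` following a step `x`. -/
def stepCost (p : ℕ) (x y : Bool) : ℕ := if x = y then p else 2

/-- The height before the first listed step, when the central step is `x`. -/
def startHeight (x : Bool) : ℤ := if x then 1 else 0

/-- The height function of a list of steps, each with its extra distance from the step before,
starting at height `h` just after a step `x`. -/
def pathFun (p : ℕ) : Bool → ℤ → List (Bool × ℕ) → ℕ → ℤ
  | _, h, [], _ => h
  | x, h, (y, e) :: L, j =>
    if j < stepGap p x y + e then h
    else pathFun p y (h + stepSign y) L (j - (stepGap p x y + e))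

/-- The total height change of a list of steps. -/
def pathSum : List (Bool × ℕ) → ℤ
  | [] => 0
  | (y, _) :: L => stepSign y + pathSum L

/-- The total symmetrized length used by a list of steps following a step `x`. -/
def pathCost (p : ℕ) : Bool → List (Bool × ℕ) → ℕ
  | _, [] => 0
  | x, (y, e) :: L => stepCost p x y + 2 * e + pathCost p y L

section pathFun

variable {p : ℕ} {x y : Bool} {h : ℤ} {e : ℕ} {L : List (Bool × ℕ)} {j : ℕ}

theorem pathFun_cons_of_lt (hj : j < stepGap p x y + e) :
    pathFun p x h ((y, e) :: L) j = h := by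
  rw [pathFun, if_pos hj]

theorem pathFun_cons_add (j : ℕ) :
    pathFun p x h ((y, e) :: L) (stepGap p x y + e + j) = pathFun p y (h + stepSign y) L j := by
  rw [pathFun, if_neg (by omega), Nat.add_sub_cancel_left]

theorem pathFun_cons_of_le (hj : stepGap p x y + e ≤ j) :
    pathFun p x h ((y, e) :: L) j =
      pathFun p y (h + stepSign y) L (j - (stepGap p x y + e)) := by
  rw [pathFun, if_neg (by omega)]

theorem pathFun_true_zero (hp : 1 ≤ p) (h : ℤ) (L : List (Bool × ℕ)) :
    pathFun p true h L 0 = h := by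
  rcases L with _ | ⟨⟨y, e⟩, L⟩
  · rfl
  · apply pathFun_cons_of_lt
    cases y <;> simp [stepGap]; omega

theorem pathFun_zero_le (hp : 1 ≤ p) (x : Bool) (h : ℤ) (L : List (Bool × ℕ)) :
    pathFun p x h L 0 ≤ h := by
  induction L generalizing x h with
  | nil => exact le_rfl
  | cons a L ih =>
    obtain ⟨y, e⟩ := a
    by_cases hq : 0 < stepGap p x y + e
    · rw [pathFun_cons_of_lt hq]
    · rw [pathFun_cons_of_le (by omega)]
      have h1 := ih y (h + stepSign y)
      rw [Nat.zero_sub]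
      cases y
      · simp only [stepSign] at h1 ⊢
        simp at h1 ⊢
        omega
      · exfalso
        apply hq
        cases x <;> simp [stepGap]; omega

/-- Just after a down step the height may rise by one within distance `p`; after an up step it may
not rise within distance less than `p`. -/
theorem pathFun_le (hp : 1 ≤ p) (x : Bool) (h : ℤ) (L : List (Bool × ℕ)) (j : ℕ) :
    (j < p → pathFun p x h L j ≤ h + 1 - startHeight x) ∧ (j ≤ p → pathFun p x h L j ≤ h + 1) := by
  induction L generalizing x h j with
  | nil =>
    simp only [pathFun, startHeight]
    split_ifs <;> omega
  | cons a L ih =>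
    obtain ⟨y, e⟩ := a
    by_cases hq : j < stepGap p x y + e
    · rw [pathFun_cons_of_lt hq]
      simp only [startHeight]
      split_ifs <;> omega
    · rw [pathFun_cons_of_le (by omega)]
      have h1 := ih y (h + stepSign y) (j - (stepGap p x y + e))
      cases x <;> cases y <;> simp [stepGap, stepSign, startHeight] at h1 hq ⊢ <;> omega

theorem pathFun_le_add_one (hp : 1 ≤ p) (x : Bool) (h : ℤ) (L : List (Bool × ℕ)) (i j : ℕ)
    (hij : i ≤ j) (hjp : j ≤ i + p) : pathFun p x h L j ≤ pathFun p x h L i + 1 := by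
  induction L generalizing x h i j with
  | nil => simp [pathFun]
  | cons a L ih =>
    obtain ⟨y, e⟩ := a
    by_cases hj : j < stepGap p x y + e
    · rw [pathFun_cons_of_lt hj, pathFun_cons_of_lt (by omega)]
      omega
    · rw [pathFun_cons_of_le (j := j) (by omega)]
      by_cases hi : i < stepGap p x y + e
      · rw [pathFun_cons_of_lt hi]
        have h1 := pathFun_le hp y (h + stepSign y) L (j - (stepGap p x y + e))
        cases y <;> simp [stepSign, startHeight] at h1 ⊢ <;> omega
      · rw [pathFun_cons_of_le (j := i) (by omega)]
        exact ih y _ _ _ (by omega) (by omega)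

/-- The bookkeeping identity between distances and symmetrized lengths. -/
theorem two_mul_stepGap (p : ℕ) (x y : Bool) (h : ℤ) :
    2 * (stepGap p x y : ℤ) =
      stepCost p x y + p * (h + stepSign y - startHeight y) - p * (h - startHeight x) := by
  cases x <;> cases y <;> simp [stepGap, stepCost, stepSign, startHeight] <;> ring

/-- `R` stands for `s` minus twice the current position. The cost inequality is invariant under
removing a step, by `two_mul_stepGap`. The clause for `x = true` records that an up step reaching `h
≤ 0` comes from a negative height, which needs room `p` before the midpoint. -/
theorem pathFun_end_bounds (hp : 1 ≤ p) (x : Bool) (h R : ℤ) (L : List (Bool × ℕ))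
    (hsum : h + pathSum L = 0) (hcost : (pathCost p x L : ℤ) ≤ R + p * (h - startHeight x)) :
    0 ≤ R ∧ (x = true → h ≤ 0 → p ≤ R) ∧ (∀ j : ℕ, R ≤ 2 * j + 1 → pathFun p x h L j = 0) ∧
      ∀ j : ℕ, pathFun p x h L j < 0 → 2 * j + p + 2 ≤ R := by
  induction L generalizing x h R with
  | nil =>
    simp only [pathSum, add_zero] at hsum
    subst hsum
    simp only [pathCost, pathFun] at hcost ⊢
    cases x <;> simp [startHeight] at hcost ⊢ <;> omega
  | cons a L ih =>
    obtain ⟨y, e⟩ := a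
    simp only [pathSum, pathCost] at hsum hcost
    push_cast at hcost
    have hid := two_mul_stepGap p x y h
    obtain ⟨h1, h2, h3, h4⟩ := ih y (h + stepSign y) (R - 2 * (stepGap p x y + e)) (by omega)
      (by linarith)
    have h5 := pathFun_zero_le hp y (h + stepSign y) L
    have h6 := h4 0
    refine ⟨by omega, ?_, fun j hj => ?_, fun j hj => ?_⟩
    · rintro rfl hh
      cases y <;> simp [stepGap, stepSign] at h1 h2 h5 h6 ⊢ <;> omega
    · rw [pathFun_cons_of_le (by omega)]
      exact h3 _ (by omega)
    · by_cases hq : j < stepGap p x y + e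
      · rw [pathFun_cons_of_lt hq] at hj
        cases y
        · simp [stepSign] at h1 h2 h5 h6
          omega
        · simp only [stepSign, if_true, true_implies] at h1 h2 h5 h6
          omega
      · rw [pathFun_cons_of_le (by omega)] at hj
        have := h4 _ hj
        omega

theorem pathCost_le_of_end_bounds (x : Bool) (h R : ℤ) (L : List (Bool × ℕ))
    (hsum : h + pathSum L = 0) (hR : 0 ≤ R) (hx : x = true → h ≤ 0 → p ≤ R)
    (hz : ∀ j : ℕ, R ≤ 2 * j + 1 → pathFun p x h L j = 0)
    (hn : ∀ j : ℕ, pathFun p x h L j < 0 → 2 * j + p + 2 ≤ R) (hp : 1 ≤ p) :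
    (pathCost p x L : ℤ) ≤ R + p * (h - startHeight x) := by
  induction L generalizing x h R with
  | nil =>
    simp only [pathSum, add_zero] at hsum
    subst hsum
    cases x <;> simp [pathCost, startHeight] at hx ⊢ <;> omega
  | cons a L ih =>
    obtain ⟨y, e⟩ := a
    simp only [pathSum, pathCost] at hsum ⊢
    push_cast
    have hid := two_mul_stepGap p x y h
    have hadd := fun j => pathFun_cons_add (p := p) (x := x) (y := y) (h := h) (e := e) (L := L) j
    have hfq := hadd 0
    have h5 := pathFun_zero_le hp y (h + stepSign y) L
    set q := stepGap p x y + e with hq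
    -- Otherwise positions `q - 1` and `q` both lie where the function vanishes, although a step
    -- changes the height at `q`.
    have hR' : 0 ≤ R - 2 * q := by
      by_contra hlt
      have h1 : pathFun p x h ((y, e) :: L) (q - 1) = h := pathFun_cons_of_lt (by omega)
      rw [hz _ (by omega)] at h1
      rw [hz _ (by omega)] at hfq
      cases y
      · simp only [stepSign] at h5 hfq
        simp at h5 hfq
        omega
      · rw [pathFun_true_zero hp] at hfq
        simp [stepSign] at hfq
        omega
    have := ih y (h + stepSign y) (R - 2 * q) (by omega) hR' ?_ ?_ ?_
    · rw [hq] at this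
      push_cast at this
      linarith
    · rintro rfl hh
      have hq1 : 1 ≤ q := by
        rw [hq]
        cases x <;> simp [stepGap]; omega
      have h1 : pathFun p x h ((true, e) :: L) (q - 1) = h := pathFun_cons_of_lt (by omega)
      have h2 := hn (q - 1)
      rw [h1] at h2
      simp [stepSign] at hh
      omega
    · intro j hj
      rw [← hadd]
      exact hz _ (by omega)
    · intro j hj
      rw [← hadd] at hj
      have := hn _ hj
      omega

theorem pathFun_cons_ne (hp : 1 ≤ p) :
    (y = true → h < pathFun p x h ((y, e) :: L) (stepGap p x y + e)) ∧
      (y = false → pathFun p x h ((y, e) :: L) (stepGap p x y + e) < h) := by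
  have h1 := pathFun_cons_add (p := p) (x := x) (y := y) (h := h) (e := e) (L := L) 0
  rw [add_zero] at h1
  rw [h1]
  constructor
  · rintro rfl
    rw [pathFun_true_zero hp]
    simp [stepSign]
  · rintro rfl
    have := pathFun_zero_le hp false (h + stepSign false) L
    simp [stepSign] at this ⊢
    omega

theorem pathFun_cons_ne_nil (hp : 1 ≤ p) : pathFun p x h ((y, e) :: L) ≠ pathFun p x h [] := by
  intro heq
  have h1 := pathFun_cons_ne (p := p) (x := x) (y := y) (h := h) (e := e) (L := L) hp
  rw [heq] at h1
  cases y <;> simp [pathFun] at h1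

/-- The first position where the function leaves `h` gives the slack, and the sign of the change
gives the direction. -/
theorem pathFun_injective (hp : 1 ≤ p) (x : Bool) (h : ℤ) :
    Function.Injective (pathFun p x h) := by
  intro L M heq
  induction L generalizing x h M with
  | nil =>
    rcases M with _ | ⟨⟨y, e⟩, M⟩
    · rfl
    · exact absurd heq.symm (pathFun_cons_ne_nil hp)
  | cons a L ih =>
    obtain ⟨y, e⟩ := a
    rcases M with _ | ⟨⟨z, e'⟩, M⟩
    · exact absurd heq (pathFun_cons_ne_nil hp)
    have h1 := pathFun_cons_ne (p := p) (x := x) (y := y) (h := h) (e := e) (L := L) hp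
    have h2 := pathFun_cons_ne (p := p) (x := x) (y := z) (h := h) (e := e') (L := M) hp
    have hq : stepGap p x y + e = stepGap p x z + e' := by
      rcases lt_trichotomy (stepGap p x y + e) (stepGap p x z + e') with hlt | heq' | hlt
      · rw [heq, pathFun_cons_of_lt hlt] at h1
        cases y <;> simp at h1
      · exact heq'
      · rw [← heq, pathFun_cons_of_lt hlt] at h2
        cases z <;> simp at h2
    have hyz : y = z := by
      rw [heq, hq] at h1
      cases y <;> cases z <;> simp at h1 h2 ⊢ <;> omega
    subst hyz
    have he : e = e' := by omega
    subst he
    congr 1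
    refine ih y (h + stepSign y) ?_
    funext j
    rw [← pathFun_cons_add (p := p) (x := x) (y := y) (h := h) (e := e) (L := L) j,
      ← pathFun_cons_add (p := p) (x := x) (y := y) (h := h) (e := e) (L := M) j, heq]

/-- Steps are peeled off at the first position where `f` leaves `h`. Either that position is
positive and the support bound `n` drops, or it is `0`, the step is down, and the remaining initial
drop `m` decreases. -/
theorem exists_pathFun_eq (hp : 1 ≤ p) (n : ℕ) (m : ℕ) (f : ℕ → ℤ) (x : Bool) (h : ℤ)
    (hz : ∀ j, n ≤ j → f j = 0) (hm : (h - f 0).toNat ≤ m)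
    (hw : ∀ i j, i ≤ j → j ≤ i + p → f j ≤ f i + 1) (h0 : f 0 ≤ h)
    (hx : x = true → f 0 = h ∧ ∀ j < p, f j ≤ h) (hx' : ∀ j ≤ p, f j ≤ h + 1) :
    ∃ L, pathFun p x h L = f := by
  induction n using Nat.strong_induction_on generalizing m f x h with
  | _ n ihn =>
  induction m using Nat.strong_induction_on generalizing f x h with
  | _ m ihm =>
  by_cases hc : ∀ j, f j = h
  · exact ⟨[], funext fun j => (hc j).symm⟩
  push Not at hc
  classical
  obtain ⟨q, hq, hmin⟩ : ∃ q, f q ≠ h ∧ ∀ j < q, f j = h :=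
    ⟨Nat.find hc, Nat.find_spec hc, fun j hj => not_not.1 (Nat.find_min hc hj)⟩
  suffices hs : ∃ (y : Bool) (L : List (Bool × ℕ)), stepGap p x y ≤ q ∧
      pathFun p y (h + stepSign y) L = fun j => f (q + j) by
    obtain ⟨y, L, hg, hL⟩ := hs
    refine ⟨(y, q - stepGap p x y) :: L, funext fun j => ?_⟩
    by_cases hj : j < q
    · rw [pathFun_cons_of_lt (by omega), hmin j hj]
    · rw [pathFun_cons_of_le (by omega), hL]
      show f _ = f j
      congr 1
      omega
  have hwq : ∀ i j, i ≤ j → j ≤ i + p → f (q + j) ≤ f (q + i) + 1 := fun i j h1 h2 =>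
    hw _ _ (by omega) (by omega)
  rcases lt_or_gt_of_ne hq with hlt | hgt
  · refine ⟨false, ?_⟩
    have hsg : h + stepSign false = h - 1 := rfl
    rw [hsg]
    have hxq : x = true → 1 ≤ q := by
      intro hxt
      by_contra hq0
      have hq0 : q = 0 := by omega
      rw [hq0] at hlt
      have := (hx hxt).1
      omega
    have hgap : stepGap p x false ≤ q := by
      cases x
      · simp [stepGap]
      · simpa [stepGap] using hxq
    have hup : ∀ j ≤ p, f (q + j) ≤ h - 1 + 1 := fun j hj => by
      have := hw q (q + j) (by omega) (by omega)
      omega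
    rcases Nat.eq_zero_or_pos q with rfl | hq1
    · obtain ⟨L, hL⟩ := ihm (h - 1 - f 0).toNat (by omega) (fun j => f (0 + j)) false (h - 1)
        (fun j hj => hz _ (by omega)) le_rfl hwq (show f 0 ≤ h - 1 by omega)
        (by simp) hup
      exact ⟨L, hgap, hL⟩
    · have hn : 1 ≤ n := by
        by_contra hn0
        exact hq (by rw [← hmin 0 hq1, hz 0 (by omega), hz q (by omega)])
      obtain ⟨L, hL⟩ := ihn (n - 1) (by omega) _ (fun j => f (q + j)) false (h - 1)
        (fun j hj => hz _ (by omega)) le_rfl hwq (show f q ≤ h - 1 by omega) (by simp) hup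
      exact ⟨L, hgap, hL⟩
  · refine ⟨true, ?_⟩
    have hsg : h + stepSign true = h + 1 := rfl
    rw [hsg]
    have hq1 : 1 ≤ q := by
      by_contra hq0
      have hq0 : q = 0 := by omega
      rw [hq0] at hgt
      omega
    have hprev := hmin (q - 1) (by omega)
    have hfq : f q = h + 1 := by
      have := hw (q - 1) q (by omega) (by omega)
      omega
    have hgap : stepGap p x true ≤ q := by
      cases x
      · simpa [stepGap] using hq1
      · simp only [stepGap, if_true]
        by_contra hlt
        have := (hx rfl).2 q (by omega)
        omega
    have hn : 1 ≤ n := by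
      by_contra hn0
      exact hq (by rw [← hmin 0 hq1, hz 0 (by omega), hz q (by omega)])
    obtain ⟨L, hL⟩ := ihn (n - 1) (by omega) _ (fun j => f (q + j)) true (h + 1)
      (fun j hj => hz _ (by omega)) le_rfl hwq (show f q ≤ h + 1 by omega)
      (fun _ => ⟨hfq, fun j hj => by
        have := hw (q - 1) (q + j) (by omega) (by omega)
        omega⟩)
      (fun j hj => by
        have := hw q (q + j) (by omega) (by omega)
        omega)
    exact ⟨L, hgap, hL⟩

theorem pathFun_eventually (x : Bool) (h : ℤ) (L : List (Bool × ℕ)) :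
    ∃ n, ∀ j, n ≤ j → pathFun p x h L j = h + pathSum L := by
  induction L generalizing x h with
  | nil => exact ⟨0, fun j _ => (add_zero h).symm⟩
  | cons a L ih =>
    obtain ⟨y, e⟩ := a
    obtain ⟨n, hn⟩ := ih y (h + stepSign y)
    refine ⟨stepGap p x y + e + n, fun j hj => ?_⟩
    rw [pathFun_cons_of_le (by omega), hn _ (by omega), pathSum, add_assoc]

end pathFun

/-- Pairs of a central step and a list of steps that encode half-period height functions. -/
def balancedPaths (s p : ℕ) : Set (Bool × List (Bool × ℕ)) :=
  {q | startHeight q.1 + pathSum q.2 = 0 ∧ pathCost p q.1 q.2 ≤ s}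

theorem pathFun_injOn_balancedPaths {s p : ℕ} (hp : 1 ≤ p) :
    Set.InjOn (fun q => pathFun p q.1 (startHeight q.1) q.2) (balancedPaths s p) := by
  rintro ⟨x, L⟩ - ⟨y, M⟩ - heq
  have heq : pathFun p x (startHeight x) L = pathFun p y (startHeight y) M := heq
  have hxy : x = y := by
    have h1 := pathFun_zero_le hp x (startHeight x) L
    have h2 := pathFun_zero_le hp y (startHeight y) M
    have h3 := congrFun heq 0
    cases x <;> cases y <;> try rfl
    · rw [pathFun_true_zero hp (startHeight true)] at h3
      simp [startHeight] at h1 h3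
      omega
    · rw [pathFun_true_zero hp (startHeight true)] at h3
      simp [startHeight] at h2 h3
      omega
  subst hxy
  rw [pathFun_injective hp x _ heq]

theorem image_pathFun_balancedPaths {s p : ℕ} (hp : 1 ≤ p) :
    (fun q => pathFun p q.1 (startHeight q.1) q.2) '' balancedPaths s p =
      {f | IsHalfProfile s p f} := by
  ext f
  constructor
  · rintro ⟨⟨x, L⟩, ⟨hsum, hcost⟩, rfl⟩
    simp only at hsum hcost
    obtain ⟨-, -, hz, hn⟩ := pathFun_end_bounds hp x (startHeight x) s L hsum (by
      rw [sub_self, mul_zero, add_zero]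
      exact_mod_cast hcost)
    refine ⟨fun j hj => hz j (by exact_mod_cast hj),
      fun i j => pathFun_le_add_one hp x _ L i j, fun j hj => ?_,
      fun j hj => by exact_mod_cast hn j hj⟩
    have := (pathFun_le hp x (startHeight x) L j).1 hj
    show pathFun p x (startHeight x) L j ≤ 1
    omega
  · intro hf
    have hf : IsHalfProfile s p f := hf
    have h01 := hf.le_one 0 (by omega)
    -- The central step goes from `1 - startHeight x` to `startHeight x`: it is up exactly when `f 0
    -- = 1`, since otherwise `f 0 ≤ 0`.
    obtain ⟨x, hx, hx0, hxp⟩ : ∃ x : Bool, f 0 ≤ startHeight x ∧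
        (x = true → f 0 = startHeight x) ∧ (∀ j ≤ p, f j ≤ startHeight x + 1) := by
      by_cases h1 : f 0 = 1
      · refine ⟨true, by simp [startHeight, h1], by simp [startHeight, h1], fun j hj => ?_⟩
        have := hf.le_add_one 0 j (by omega) (by omega)
        simp only [startHeight, if_true]
        omega
      · refine ⟨false, ?_, by simp, fun j hj => ?_⟩
        · simp only [startHeight]
          simp
          omega
        · have := hf.le_add_one 0 j (by omega) (by omega)
          simp only [startHeight]
          simp
          omega
    obtain ⟨L, hL⟩ := exists_pathFun_eq hp s _ f x (startHeight x)
      (fun j hj => hf.eq_zero j (by omega)) le_rfl hf.le_add_one hx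
      (fun hxt => ⟨hx0 hxt, fun j hj => by
        have := hf.le_one j hj
        rw [hxt]
        exact this⟩) hxp
    have hsum : startHeight x + pathSum L = 0 := by
      obtain ⟨n, hn⟩ := pathFun_eventually (p := p) x (startHeight x) L
      rw [← hn (n + s) (by omega), hL, hf.eq_zero _ (by omega)]
    refine ⟨(x, L), ⟨hsum, ?_⟩, hL⟩
    have := pathCost_le_of_end_bounds (p := p) x (startHeight x) s L hsum (by omega)
      (fun hxt => by rw [hxt]; simp [startHeight])
      (fun j hj => by rw [hL]; exact hf.eq_zero j (by exact_mod_cast hj))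
      (fun j hj => by rw [hL] at hj; exact_mod_cast hf.of_neg j hj) hp
    rw [sub_self, mul_zero, add_zero] at this
    exact_mod_cast this

/-! ### Counting direction words -/

/-- The number of letters of a word that differ from the letter before them, where the first letter
is preceded by `x`. -/
def letterChanges : Bool → List Bool → ℕ
  | _, [] => 0
  | x, y :: w => (if x = y then 0 else 1) + letterChanges y w

theorem letterChanges_le_length (x : Bool) (w : List Bool) : letterChanges x w ≤ w.length := by
  induction w generalizing x with
  | nil => simp [letterChanges]
  | cons y w ih =>
    have := ih y
    simp only [letterChanges, List.length_cons]
    split_ifs <;> omega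

/-- The words with `a` letters `!x`, `b` letters `x` and `v` letter changes when preceded by `x`. -/
def wordSet (x : Bool) (a b v : ℕ) : Set (List Bool) :=
  {w | w.count (!x) = a ∧ w.count x = b ∧ letterChanges x w = v}

/-- The number of words in `wordSet x a b v`. -/
def wordCount : ℕ → ℕ → ℕ → ℕ
  | 0, _, 0 => 1
  | 0, _, _ + 1 => 0
  | _ + 1, _, 0 => 0
  | a + 1, b, v + 1 => b.choose ((v + 1) / 2) * a.choose (v / 2)

theorem wordCount_succ_zero_succ (a v : ℕ) : wordCount (a + 1) 0 (v + 1) = wordCount 0 a v := by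
  rcases v with _ | v
  · simp [wordCount]
  · rw [wordCount, wordCount, show (v + 1 + 1) / 2 = v / 2 + 1 by omega]
    simp

theorem wordCount_succ_succ_succ (a b v : ℕ) :
    wordCount (a + 1) (b + 1) (v + 1) = wordCount (a + 1) b (v + 1) + wordCount (b + 1) a v := by
  rcases v with _ | v
  · simp [wordCount]
  · rw [wordCount, wordCount, wordCount, show (v + 1 + 1) / 2 = v / 2 + 1 by omega,
      Nat.choose_succ_succ]
    ring

theorem mem_wordSet_cons_self {x : Bool} {a b v : ℕ} {w : List Bool} :
    x :: w ∈ wordSet x a (b + 1) v ↔ w ∈ wordSet x a b v := by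
  show ((x :: w).count (!x) = a ∧ (x :: w).count x = b + 1 ∧ letterChanges x (x :: w) = v) ↔
    (w.count (!x) = a ∧ w.count x = b ∧ letterChanges x w = v)
  cases x <;> simp [letterChanges]

theorem mem_wordSet_cons_not {x : Bool} {a b v : ℕ} {w : List Bool} :
    (!x) :: w ∈ wordSet x (a + 1) b (v + 1) ↔ w ∈ wordSet (!x) b a v := by
  show (((!x) :: w).count (!x) = a + 1 ∧ ((!x) :: w).count x = b ∧
    letterChanges x ((!x) :: w) = v + 1) ↔
    (w.count (!!x) = b ∧ w.count (!x) = a ∧ letterChanges (!x) w = v)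
  cases x <;> simp [letterChanges, add_comm 1] <;> tauto

theorem wordSet_eq_union (x : Bool) (a b v : ℕ) (hab : a + b ≠ 0) :
    wordSet x a b v =
      (if b = 0 then ∅ else List.cons x '' wordSet x a (b - 1) v) ∪
        (if a = 0 ∨ v = 0 then ∅ else List.cons (!x) '' wordSet (!x) b (a - 1) (v - 1)) := by
  ext w
  constructor
  · intro hw
    rcases w with _ | ⟨y, w⟩
    · obtain ⟨h1, h2, h3⟩ := hw
      simp at h1 h2
      omega
    · rcases Bool.eq_or_eq_not y x with rfl | rfl
      · left
        rcases b with _ | b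
        · obtain ⟨-, h2, -⟩ := hw
          simp at h2
        · rw [if_neg (by omega)]
          exact ⟨w, mem_wordSet_cons_self.1 hw, rfl⟩
      · right
        rcases a with _ | a
        · obtain ⟨h2, -, -⟩ := hw
          simp at h2
        · rcases v with _ | v
          · obtain ⟨-, -, h2⟩ := hw
            simp [letterChanges] at h2
          · rw [if_neg (by omega)]
            exact ⟨w, mem_wordSet_cons_not.1 hw, rfl⟩
  · rintro (hw | hw)
    · split_ifs at hw with h
      · exact hw.elim
      · obtain ⟨w, hw, rfl⟩ := hw
        obtain ⟨b, rfl⟩ : ∃ c, b = c + 1 := ⟨b - 1, by omega⟩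
        exact mem_wordSet_cons_self.2 hw
    · split_ifs at hw with h
      · exact hw.elim
      · obtain ⟨w, hw, rfl⟩ := hw
        obtain ⟨a, rfl⟩ : ∃ c, a = c + 1 := ⟨a - 1, by omega⟩
        obtain ⟨v, rfl⟩ : ∃ c, v = c + 1 := ⟨v - 1, by omega⟩
        exact mem_wordSet_cons_not.2 hw

/-- Removing the first letter yields the recursion of `wordCount`. Its closed form counts runs:
those of `!x` are nonempty, while the run of `x` continuing the preceding letter may be empty. -/
theorem finite_wordSet_and_ncard (x : Bool) (a b v : ℕ) :
    (wordSet x a b v).Finite ∧ (wordSet x a b v).ncard = wordCount a b v := by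
  induction hn : a + b generalizing x a b v with
  | zero =>
    obtain ⟨rfl, rfl⟩ : a = 0 ∧ b = 0 := by omega
    have hnil : ∀ w ∈ wordSet x 0 0 v, w = [] := by
      rintro (_ | ⟨y, w⟩) ⟨h1, h2, -⟩
      · rfl
      · cases x <;> cases y <;> simp at h1 h2
    rcases v with _ | v
    · have : wordSet x 0 0 0 = {[]} := by
        ext w
        refine ⟨hnil w, ?_⟩
        rintro rfl
        exact ⟨by simp, by simp, rfl⟩
      rw [this]
      exact ⟨Set.finite_singleton _, Set.ncard_singleton _⟩
    · have : wordSet x 0 0 (v + 1) = ∅ := by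
        ext w
        refine ⟨fun hw => ?_, fun hw => hw.elim⟩
        have := hnil w hw
        subst this
        obtain ⟨-, -, h⟩ := hw
        simp [letterChanges] at h
      rw [this]
      exact ⟨Set.finite_empty, Set.ncard_empty _⟩
  | succ n ih =>
    have hinj : ∀ y : Bool, Function.Injective (List.cons y) := fun y => List.cons_injective
    set A : Set (List Bool) := if b = 0 then ∅ else List.cons x '' wordSet x a (b - 1) v with hA
    set B : Set (List Bool) :=
      if a = 0 ∨ v = 0 then ∅ else List.cons (!x) '' wordSet (!x) b (a - 1) (v - 1) with hB
    have hAc : A.Finite ∧ A.ncard = if b = 0 then 0 else wordCount a (b - 1) v := by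
      rw [hA]
      split_ifs with h
      · exact ⟨Set.finite_empty, Set.ncard_empty _⟩
      · have := ih x a (b - 1) v (by omega)
        rw [Set.ncard_image_of_injective _ (hinj x)]
        exact ⟨this.1.image _, this.2⟩
    have hBc : B.Finite ∧ B.ncard = if a = 0 ∨ v = 0 then 0 else wordCount b (a - 1) (v - 1) := by
      rw [hB]
      split_ifs with h
      · exact ⟨Set.finite_empty, Set.ncard_empty _⟩
      · have := ih (!x) b (a - 1) (v - 1) (by omega)
        rw [Set.ncard_image_of_injective _ (hinj _)]
        exact ⟨this.1.image _, this.2⟩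
    have hdisj : Disjoint A B := by
      rw [Set.disjoint_left]
      intro w h1 h2
      rw [hA] at h1
      rw [hB] at h2
      split_ifs at h1 with hb
      · exact h1
      split_ifs at h2 with ha
      · exact h2
      obtain ⟨w1, -, rfl⟩ := h1
      obtain ⟨w2, -, h⟩ := h2
      cases x <;> simp at h
    rw [wordSet_eq_union x a b v (by omega), ← hA, ← hB]
    refine ⟨hAc.1.union hBc.1, ?_⟩
    rw [Set.ncard_union_eq hdisj hAc.1 hBc.1, hAc.2, hBc.2]
    rcases a with _ | a <;> rcases b with _ | b <;> rcases v with _ | v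
    all_goals simp only [Nat.add_sub_cancel, Nat.succ_ne_zero, or_false, or_true,
      if_true, if_false, zero_add, add_zero]
    all_goals first
      | omega
      | exact (wordCount_succ_zero_succ _ _).symm
      | exact (wordCount_succ_succ_succ _ _ _).symm
      | rfl

/-! ### Counting slack vectors -/

/-- The lists of `k` natural numbers with sum at most `M`. -/
def boundedLists (k M : ℕ) : Set (List ℕ) := {e | e.length = k ∧ e.sum ≤ M}

/-- Pascal's rule: the first entry is either zero and is dropped, or positive and is decreased by
one. -/
theorem finite_boundedLists_and_ncard (k M : ℕ) :
    (boundedLists k M).Finite ∧ (boundedLists k M).ncard = (M + k).choose k := by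
  induction k generalizing M with
  | zero =>
    have : boundedLists 0 M = {[]} := by
      ext e
      constructor
      · rintro ⟨h, -⟩
        exact List.eq_nil_of_length_eq_zero h
      · rintro rfl
        exact ⟨rfl, by simp⟩
    rw [this]
    simp
  | succ k ihk =>
    induction M with
    | zero =>
      have : boundedLists (k + 1) 0 = List.cons 0 '' boundedLists k 0 := by
        ext e
        constructor
        · rintro ⟨h1, h2⟩
          rcases e with _ | ⟨n, e⟩
          · simp at h1
          · simp only [List.length_cons, List.sum_cons] at h1 h2
            obtain rfl : n = 0 := by omega
            exact ⟨e, ⟨by omega, by omega⟩, rfl⟩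
        · rintro ⟨e, ⟨h1, h2⟩, rfl⟩
          exact ⟨by simp [h1], by simpa using h2⟩
      rw [this, Set.ncard_image_of_injective _ List.cons_injective, (ihk 0).2]
      exact ⟨(ihk 0).1.image _, by simp⟩
    | succ M ihM =>
      -- Only nonempty lists are used here, so the default of `headD` never matters.
      set inc : List ℕ → List ℕ := fun e => (e.headD 0 + 1) :: e.tail with hinc
      have hsplit : boundedLists (k + 1) (M + 1) =
          List.cons 0 '' boundedLists k (M + 1) ∪ inc '' boundedLists (k + 1) M := by
        ext e
        constructor
        · rintro ⟨h1, h2⟩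
          rcases e with _ | ⟨_ | n, e⟩
          · simp at h1
          · simp only [List.length_cons, List.sum_cons] at h1 h2
            exact Or.inl ⟨e, ⟨by omega, by omega⟩, rfl⟩
          · simp only [List.length_cons, List.sum_cons] at h1 h2
            exact Or.inr ⟨n :: e, ⟨h1, by simp only [List.sum_cons]; omega⟩, rfl⟩
        · rintro (⟨e, ⟨h1, h2⟩, rfl⟩ | ⟨e, ⟨h1, h2⟩, rfl⟩)
          · exact ⟨by simp [h1], by simpa using h2⟩
          · rcases e with _ | ⟨n, e⟩
            · simp at h1
            · simp only [List.length_cons, List.sum_cons] at h1 h2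
              exact ⟨by simp [hinc, h1], by simp [hinc]; omega⟩
      have hdisj : Disjoint (List.cons 0 '' boundedLists k (M + 1))
          (inc '' boundedLists (k + 1) M) := by
        rw [Set.disjoint_left]
        rintro _ ⟨e, -, rfl⟩ ⟨e', -, h⟩
        simp [hinc] at h
      have hinj : Set.InjOn inc (boundedLists (k + 1) M) := by
        rintro e ⟨h1, -⟩ e' ⟨h2, -⟩ h
        rcases e with _ | ⟨n, e⟩
        · simp at h1
        rcases e' with _ | ⟨n', e'⟩
        · simp at h2
        simpa [hinc] using h
      rw [hsplit]
      refine ⟨((ihk _).1.image _).union (ihM.1.image _), ?_⟩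
      rw [Set.ncard_union_eq hdisj ((ihk _).1.image _) (ihM.1.image _),
        Set.ncard_image_of_injective _ List.cons_injective, hinj.ncard_image, (ihk _).2, ihM.2,
        show M + 1 + (k + 1) = (M + 1 + k) + 1 by ring, Nat.choose_succ_succ,
        show M + (k + 1) = M + 1 + k by ring]

/-! ### Counting balanced paths by length and repetitions -/

theorem pathCost_zip {p : ℕ} (hp : 2 ≤ p) (x : Bool) (w : List Bool) (e : List ℕ)
    (h : w.length = e.length) :
    pathCost p x (w.zip e) + (p - 2) * letterChanges x w = p * w.length + 2 * e.sum := by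
  induction w generalizing x e with
  | nil =>
    rcases e with _ | ⟨n, e⟩
    · simp [pathCost, letterChanges]
    · simp at h
  | cons y w ih =>
    rcases e with _ | ⟨n, e⟩
    · simp at h
    · have := ih y e (by simpa using h)
      obtain ⟨p, rfl⟩ : ∃ q, p = q + 2 := ⟨p - 2, by omega⟩
      simp only [Nat.add_sub_cancel] at this ⊢
      simp only [List.zip_cons_cons, pathCost, letterChanges, List.length_cons, List.sum_cons,
        stepCost]
      split_ifs <;> linarith

theorem pathSum_zip (w : List Bool) (e : List ℕ) (h : w.length = e.length) :
    pathSum (w.zip e) = w.count true - w.count false := by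
  induction w generalizing e with
  | nil => simp [pathSum]
  | cons y w ih =>
    rcases e with _ | ⟨n, e⟩
    · simp at h
    · have := ih e (by simpa using h)
      simp only [List.zip_cons_cons, pathSum, this, stepSign]
      cases y <;> simp <;> ring

theorem count_true_add_count_false (w : List Bool) : w.count true + w.count false = w.length := by
  induction w with
  | nil => simp
  | cons y w ih => cases y <;> simp <;> omega

/-- Balance forces the central step: down for even length, up for odd length. Counting letters
relative to `x` treats both parities at once. -/
theorem startHeight_add_eq_zero_iff (x : Bool) (w : List Bool) :
    startHeight x + ((w.count true : ℤ) - w.count false) = 0 ↔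
      x = decide (w.length % 2 = 1) ∧ w.count (!x) = (w.length + 1) / 2 ∧
        w.count x = w.length / 2 := by
  have h := count_true_add_count_false w
  cases x <;> simp [startHeight] <;> omega

/-- The balanced paths with `k` steps, `l` of which repeat the step before. -/
def balancedPathsWith (s p k l : ℕ) : Set (Bool × List (Bool × ℕ)) :=
  {q ∈ balancedPaths s p | q.2.length = k ∧ letterChanges q.1 (q.2.map Prod.fst) + l = k}

theorem balancedPathsWith_eq_image {s p k l : ℕ} (hp : 2 ≤ p) (hl : l ≤ k)
    (hs : 2 * k + l * (p - 2) ≤ s) :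
    balancedPathsWith s p k l =
      (fun t : List Bool × List ℕ => (decide (k % 2 = 1), t.1.zip t.2)) ''
        (wordSet (decide (k % 2 = 1)) ((k + 1) / 2) (k / 2) (k - l) ×ˢ
          boundedLists k ((s - (2 * k + l * (p - 2))) / 2)) := by
  have hcost : ∀ (x : Bool) (w : List Bool) (e : List ℕ), w.length = k → e.length = k →
      letterChanges x w + l = k →
      pathCost p x (w.zip e) = 2 * k + l * (p - 2) + 2 * e.sum := by
    intro x w e hw he hv
    have h1 := pathCost_zip hp x w e (hw.trans he.symm)
    obtain ⟨p, rfl⟩ : ∃ q, p = q + 2 := ⟨p - 2, by omega⟩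
    simp only [Nat.add_sub_cancel] at h1 ⊢
    rw [hw] at h1
    have h2 : p * letterChanges x w + p * l = p * k := by rw [← mul_add, hv]
    linarith
  ext ⟨x, L⟩
  constructor
  · rintro ⟨⟨h1, h2⟩, h3, h4⟩
    simp only at h1 h2 h3 h4
    have hL : (L.map Prod.fst).zip (L.map Prod.snd) = L := by
      rw [← List.unzip_fst, ← List.unzip_snd, List.zip_unzip]
    have hlen : (L.map Prod.fst).length = k := by simpa using h3
    have hlen' : (L.map Prod.snd).length = k := by simpa using h3
    rw [← hL] at h1 h2
    rw [pathSum_zip _ _ (hlen.trans hlen'.symm), startHeight_add_eq_zero_iff, hlen] at h1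
    rw [hcost x _ _ hlen hlen' h4] at h2
    obtain ⟨rfl, h5, h6⟩ := h1
    refine ⟨(L.map Prod.fst, L.map Prod.snd), ⟨⟨h5, h6, ?_⟩, hlen', ?_⟩, ?_⟩
    · show letterChanges _ (L.map Prod.fst) = k - l
      omega
    · show (L.map Prod.snd).sum ≤ _
      omega
    · simp only [hL]
  · rintro ⟨⟨w, e⟩, ⟨⟨h1, h2, h3⟩, he, hM⟩, heq⟩
    simp only [Prod.mk.injEq] at h1 h2 h3 he hM heq
    obtain ⟨rfl, rfl⟩ := heq
    have hw : w.length = k := by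
      have := count_true_add_count_false w
      cases hx : decide (k % 2 = 1) <;> rw [hx] at h1 h2 <;> simp at h1 h2 <;> omega
    have hv : letterChanges (decide (k % 2 = 1)) w + l = k := by omega
    refine ⟨⟨?_, ?_⟩, ?_, ?_⟩
    · show startHeight _ + pathSum (w.zip e) = 0
      rw [pathSum_zip _ _ (hw.trans he.symm), startHeight_add_eq_zero_iff, hw]
      exact ⟨rfl, h1, h2⟩
    · show pathCost p _ (w.zip e) ≤ s
      rw [hcost _ _ _ hw he hv]
      omega
    · simp [hw, he]
    · show letterChanges _ ((w.zip e).map Prod.fst) + l = k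
      rw [List.map_fst_zip (by omega)]
      exact hv

theorem finite_balancedPathsWith_and_ncard {s p k l : ℕ} (hp : 2 ≤ p) (hl : l ≤ k)
    (hs : 2 * k + l * (p - 2) ≤ s) :
    (balancedPathsWith s p k l).Finite ∧ (balancedPathsWith s p k l).ncard =
      wordCount ((k + 1) / 2) (k / 2) (k - l) * ((s - l * (p - 2)) / 2).choose k := by
  obtain ⟨hw, hwc⟩ :=
    finite_wordSet_and_ncard (decide (k % 2 = 1)) ((k + 1) / 2) (k / 2) (k - l)
  obtain ⟨he, hec⟩ := finite_boundedLists_and_ncard k ((s - (2 * k + l * (p - 2))) / 2)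
  rw [balancedPathsWith_eq_image hp hl hs]
  refine ⟨(hw.prod he).image _, ?_⟩
  rw [Set.InjOn.ncard_image, Set.ncard_prod, hwc, hec]
  -- Adding `k` to the slack bound turns its numerator `s - 2k - l(p-2)` into `s - l(p-2)`.
  · congr 2
    omega
  · rintro ⟨w, e⟩ ⟨⟨h1, h2, -⟩, h3, -⟩ ⟨w', e'⟩ ⟨⟨h1', h2', -⟩, h3', -⟩ h
    simp only [Prod.mk.injEq, true_and] at h1 h2 h3 h1' h2' h3' h ⊢
    have hw : w.length = k := by
      have := count_true_add_count_false w
      cases hx : decide (k % 2 = 1) <;> rw [hx] at h1 h2 <;> simp at h1 h2 <;> omega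
    have hw' : w'.length = k := by
      have := count_true_add_count_false w'
      cases hx : decide (k % 2 = 1) <;> rw [hx] at h1' h2' <;> simp at h1' h2' <;> omega
    constructor
    · rw [← List.map_fst_zip (l₁ := w) (l₂ := e) (by omega), h, List.map_fst_zip (by omega)]
    · rw [← List.map_snd_zip (l₁ := w) (l₂ := e) (by omega), h, List.map_snd_zip (by omega)]

theorem two_mul_add_le_of_mem_balancedPathsWith {s p k l : ℕ} (hp : 2 ≤ p)
    {q : Bool × List (Bool × ℕ)} (hq : q ∈ balancedPathsWith s p k l) :
    2 * k + l * (p - 2) ≤ s := by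
  obtain ⟨⟨-, h2⟩, h3, h4⟩ := hq
  have hL : (q.2.map Prod.fst).zip (q.2.map Prod.snd) = q.2 := by
    rw [← List.unzip_fst, ← List.unzip_snd, List.zip_unzip]
  have h1 := pathCost_zip hp q.1 (q.2.map Prod.fst) (q.2.map Prod.snd) (by simp)
  rw [hL, List.length_map, h3] at h1
  obtain ⟨p, rfl⟩ : ∃ r, p = r + 2 := ⟨p - 2, by omega⟩
  simp only [Nat.add_sub_cancel] at h1 ⊢
  have h5 : p * letterChanges q.1 (q.2.map Prod.fst) + p * l = p * k := by rw [← mul_add, h4]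
  linarith [Nat.zero_le (q.2.map Prod.snd).sum]

/-- Both binomials are reflected. For even `k` the factors also trade places; for odd `k` their
upper entries coincide. -/
theorem wordCount_half {k l : ℕ} (hl : l < k) :
    wordCount ((k + 1) / 2) (k / 2) (k - l) =
      ((k - 1) / 2).choose (l / 2) * (k / 2).choose ((l + 1) / 2) := by
  obtain ⟨v, hv⟩ : ∃ v, k = l + v + 1 := ⟨k - l - 1, by omega⟩
  rw [show (k + 1) / 2 = (k - 1) / 2 + 1 by omega, show k - l = v + 1 by omega, wordCount]
  rcases Nat.even_or_odd' k with ⟨j, hj | hj⟩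
  · rw [mul_comm]
    congr 1
    · exact Nat.choose_symm_of_eq_add (by omega)
    · exact Nat.choose_symm_of_eq_add (by omega)
  · rw [show (k - 1) / 2 = k / 2 by omega]
    congr 1
    · exact Nat.choose_symm_of_eq_add (by omega)
    · exact Nat.choose_symm_of_eq_add (by omega)

theorem innerBound_spec {s p k l : ℕ} (hp : 2 ≤ p) (hk : 1 ≤ k) (hks : 2 * k ≤ s) :
    l ≤ innerBound s p k ↔ l < k ∧ 2 * k + l * (p - 2) ≤ s := by
  unfold innerBound
  split_ifs with h
  · subst h
    simp only [Nat.sub_self, mul_zero]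
    omega
  · rw [le_min_iff, Nat.le_div_iff_mul_le (by omega)]
    omega

theorem finite_balancedPaths_and_ncard {s p : ℕ} (hp : 2 ≤ p) :
    (balancedPaths s p).Finite ∧ (balancedPaths s p).ncard =
      1 + ∑ k ∈ Finset.Icc 1 (s / 2), ∑ l ∈ Finset.range (innerBound s p k + 1),
        Nat.choose ((k - 1) / 2) (l / 2) * Nat.choose (k / 2) ((l + 1) / 2) *
          Nat.choose ((s - l * (p - 2)) / 2) k := by
  classical
  set T : Finset (Σ _ : ℕ, ℕ) :=
    (Finset.Icc 1 (s / 2)).sigma fun k => Finset.range (innerBound s p k + 1) with hT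
  have hmemT : ∀ i, i ∈ T ↔ 1 ≤ i.1 ∧ i.2 < i.1 ∧ 2 * i.1 + i.2 * (p - 2) ≤ s := by
    rintro ⟨k, l⟩
    simp only [hT, Finset.mem_sigma, Finset.mem_Icc, Finset.mem_range, Nat.lt_succ_iff]
    constructor
    · rintro ⟨⟨h1, h2⟩, h3⟩
      exact ⟨h1, (innerBound_spec hp h1 (by omega)).1 h3⟩
    · rintro ⟨h1, h2⟩
      exact ⟨⟨h1, by omega⟩, (innerBound_spec hp h1 (by omega)).2 h2⟩
  set ind : Bool × List (Bool × ℕ) → Σ _ : ℕ, ℕ := fun q =>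
    ⟨q.2.length, q.2.length - letterChanges q.1 (q.2.map Prod.fst)⟩ with hind
  have hfib : ∀ q ∈ balancedPaths s p, ∀ i : Σ _ : ℕ, ℕ, i.2 ≤ i.1 →
      (ind q = i ↔ q ∈ balancedPathsWith s p i.1 i.2) := by
    rintro q hq ⟨k, l⟩ hlk
    have h1 := letterChanges_le_length q.1 (q.2.map Prod.fst)
    rw [List.length_map] at h1
    simp only [hind, Sigma.mk.injEq, heq_eq_eq]
    simp only at hlk
    constructor
    · rintro ⟨h2, h3⟩
      exact ⟨hq, h2, by omega⟩
    · rintro ⟨-, h2, h3⟩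
      exact ⟨h2, by omega⟩
  have hzero := finite_balancedPathsWith_and_ncard (s := s) (k := 0) (l := 0) hp le_rfl (by simp)
  have hmaps : ∀ q ∈ balancedPaths s p, ind q ∈ insert ⟨0, 0⟩ T := by
    intro q hq
    have hle : (ind q).2 ≤ (ind q).1 := Nat.sub_le _ _
    have hw := (hfib q hq _ hle).1 rfl
    have hcost := two_mul_add_le_of_mem_balancedPathsWith hp hw
    rw [Finset.mem_insert, hmemT]
    rcases Nat.eq_zero_or_pos (ind q).1 with h0 | h0
    · left
      rw [h0, Nat.le_zero] at hle
      exact Sigma.ext h0 (heq_of_eq hle)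
    · right
      -- A nonempty balanced word contains the letter opposite to the central step, so not every
      -- step repeats its predecessor: `l = k` occurs only for `k = 0`, the source of the summand
      -- `1`.
      refine ⟨h0, lt_of_le_of_ne hle fun heq => ?_, hcost⟩
      obtain ⟨hf, hc⟩ := finite_balancedPathsWith_and_ncard hp hle hcost
      have hsub : (ind q).1 - (ind q).2 = 0 := by omega
      rw [hsub] at hc
      obtain ⟨a, ha⟩ : ∃ a, ((ind q).1 + 1) / 2 = a + 1 := ⟨((ind q).1 + 1) / 2 - 1, by omega⟩
      rw [ha, wordCount, zero_mul] at hc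
      rw [(Set.ncard_eq_zero hf).1 hc] at hw
      exact hw
  have hfin : (balancedPaths s p).Finite := by
    obtain ⟨U, hU⟩ : ∃ U, U = insert ⟨0, 0⟩ T := ⟨_, rfl⟩
    have hsub : balancedPaths s p ⊆
        ⋃ i ∈ (U : Set (Σ _ : ℕ, ℕ)), balancedPathsWith s p i.1 i.2 := by
      intro q hq
      rw [Set.mem_iUnion₂]
      exact ⟨ind q, hU ▸ hmaps q hq, (hfib q hq _ (Nat.sub_le _ _)).1 rfl⟩
    refine Set.Finite.subset (U.finite_toSet.biUnion fun i hi => ?_) hsub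
    rw [Finset.mem_coe, hU, Finset.mem_insert, hmemT] at hi
    rcases hi with rfl | ⟨h1, h2, h3⟩
    · exact hzero.1
    · exact (finite_balancedPathsWith_and_ncard hp h2.le h3).1
  refine ⟨hfin, ?_⟩
  have hcard : ∀ i : Σ _ : ℕ, ℕ, i.2 ≤ i.1 →
      (hfin.toFinset.filter fun q => ind q = i).card = (balancedPathsWith s p i.1 i.2).ncard := by
    intro i hi
    rw [← Set.ncard_coe_finset]
    congr 1
    ext q
    simp only [Finset.coe_filter, Set.Finite.mem_toFinset, Set.mem_ofPred_eq]
    constructor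
    · rintro ⟨h1, h2⟩
      exact (hfib q h1 i hi).1 h2
    · intro h1
      exact ⟨h1.1, (hfib q h1.1 i hi).2 h1⟩
  have h00 : (⟨0, 0⟩ : Σ _ : ℕ, ℕ) ∉ T := by
    rw [hmemT]
    simp
  rw [Set.ncard_eq_toFinset_card _ hfin, Finset.card_eq_sum_card_fiberwise (f := ind)
    (t := insert ⟨0, 0⟩ T) (fun q hq => hmaps q (by simpa using hq)), Finset.sum_insert h00,
    hcard _ le_rfl]
  congr 1
  · rw [hzero.2]
    simp [wordCount]
  · rw [Finset.sum_sigma' (Finset.Icc 1 (s / 2))]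
    refine Finset.sum_congr rfl fun i hi => ?_
    obtain ⟨-, h2, h3⟩ := (hmemT i).1 hi
    rw [hcard i h2.le, (finite_balancedPathsWith_and_ncard hp h2.le h3).2, wordCount_half h2]

theorem theorem3p6 (s p : ℕ) (hs : 1 ≤ s) (hp : 2 ≤ p) :
    (selfConjugateCores s p).Finite ∧
    (selfConjugateCores s p).ncard =
      1 + ∑ k ∈ Finset.Icc 1 (s / 2), ∑ l ∈ Finset.range (innerBound s p k + 1),
        Nat.choose ((k - 1) / 2) (l / 2) * Nat.choose (k / 2) ((l + 1) / 2) *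
          Nat.choose ((s - l * (p - 2)) / 2) k := by
  have hp1 : 1 ≤ p := by omega
  obtain ⟨hfin, hcard⟩ := finite_balancedPaths_and_ncard (s := s) hp
  have hprof := image_pathFun_balancedPaths (s := s) hp1
  have hcore := image_profileSet (s := s) (p := p) hs hp1
  have hyoung := image_betaSet_selfConjugateCores (s := s) (p := p) hs
  have hprof_fin : {f | IsHalfProfile s p f}.Finite := hprof ▸ hfin.image _
  have hcore_fin : {S | IsSymmetricCoreSet s p S}.Finite := hcore ▸ hprof_fin.image _
  refine ⟨Set.Finite.of_finite_image (hyoung ▸ hcore_fin)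
    YoungDiagram.betaSet_injective.injOn, ?_⟩
  rw [← Set.ncard_image_of_injective _ YoungDiagram.betaSet_injective, hyoung, ← hcore,
    (profileSet_injOn hs).ncard_image, ← hprof, (pathFun_injOn_balancedPaths hp1).ncard_image,
    hcard]
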